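/- **Setting.** Let $P\subset\mathbb R^2$ be a finite set of points, no three of them collinear and no two with the same $y$-coordinate, partitioned (parts may be empty) as $P=C\cup T_1\cup T_2$, where $C$ is in convex position and there are two horizontal lines $\ell_1,\ell_2$, with $T_1$ above $\ell_1$, $\ell_1$ above $C$, $C$ above $\ell_2$ and $\ell_2$ above $T_2$ (all strictly, and $\ell_1$ above $\ell_2$). Let $T=T_1\cup T_2$. For an integer $n\ge 0$, the *flip graph* $F(P,n)$ is the directed graph whose vertices are the multisets $S$ of $n$ segments with two distinct endpoints in $P$. Two segments *cross* if they intersect in a single point that is an endpoint of neither. There is an arc from $S$ to $S'$ if $S'$ arises from $S$ by a *flip*: two crossing segments $ab,cd$ of $S$ are removed and two non-crossing segments with the same four endpoints forming a cycle with them (that is, $ac,bd$ or $ad,bc$) are inserted. A *removal and insertion strategy* is a spanning subgraph $RI$ of $F(P,n)$ that has the same sinks as $F(P,n)$ and in which each vertex that is not a sink of $F(P,n)$ has out-degree exactly one. A *flip sequence* of $RI$ is a directed path in $RI$, its length is its number of arcs, and it is an *untangle sequence* if it ends in a sink of $F(P,n)$. For a vertex $S$ let $t(S)$ be the sum of the degrees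 of the points of $T$ in the multigraph $(P,S)$. **Theorem.** There is an absolute constant $K$ such that for all $P,C,T_1,T_2$ as above and all $n\ge 0$ there is a removal and insertion strategy $RI$ of $F(P,n)$ such that, from each vertex $S$, there is an untangle sequence of $RI$, and each flip sequence of $RI$ that starts at $S$ (in particular each untangle sequence) has length at most $$K\,\bigl(n+t(S)\,|P|\bigr)\quad\text{and at most}\quad K\,\max(1,t(S))\,n .$$ Moreover, with the same $K$, for all $n,t\ge 0$ the parameter $$d^{RI}(n,t)=\sup_{(P,C,T_1,T_2)}\ \min_{RI}\ \max\{\text{length of }\sigma : \sigma\text{ a flip sequence of }RI\text{ starting at a vertex }S\text{ with }t(S)=t\},$$ where $(P,C,T_1,T_2)$ ranges over all point sets as above and $RI$ over all removal and insertion strategies of $F(P,n)$, satisfies $d^{RI}(n,t)\le K\max(1,t)\,n$. (A maximum over an empty set is read as $0$.) -/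

import Mathlib

namespace Untangle

/-- The Euclidean plane; coordinate `0` is horizontal and coordinate `1` is vertical. -/
abbrev Plane : Type := EuclideanSpace ℝ (Fin 2)

/-- The closed straight-line segment spanned by an unordered pair of points. -/
def seg : Sym2 Plane → Set Plane :=
  Sym2.lift ⟨fun a b => segment ℝ a b, fun a b => segment_symm ℝ a b⟩

/-- Two segments cross if they meet in a single point, which is an endpoint of neither. -/
def Crosses (s₁ s₂ : Sym2 Plane) : Prop :=
  ∃ x : Plane, seg s₁ ∩ seg s₂ = {x} ∧ x ∉ s₁ ∧ x ∉ s₂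

/-- A finite point set is in general position if no three distinct points of it are collinear. -/
def GeneralPosition (P : Finset Plane) : Prop :=
  ∀ a ∈ P, ∀ b ∈ P, ∀ c ∈ P, a ≠ b → b ≠ c → a ≠ c → ¬ Collinear ℝ {a, b, c}

/-- A finite point set is in convex position if no point of it is in the convex hull of the
others. -/
def ConvexPosition (C : Finset Plane) : Prop :=
  ConvexIndependent ℝ (fun p : C => (p : Plane))

/-- The point property of the theorem: `P` is in general position, no two points of `P` have the
same height, `P` is the union of `C`, `T₁`, `T₂` with `C` in convex position, and there are two
horizontal lines `y = l₁` and `y = l₂`, the first above the second, with `T₁` above the first line,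
`C` strictly between the two lines, and `T₂` below the second line.
(The three parts may be empty; the lines force them to be pairwise disjoint.) -/
structure Separated (P C T₁ T₂ : Finset Plane) : Prop where
  generalPosition : GeneralPosition P
  distinct_heights : Set.InjOn (fun p : Plane => p 1) (P : Set Plane)
  cover : (P : Set Plane) = (C : Set Plane) ∪ (T₁ : Set Plane) ∪ (T₂ : Set Plane)
  convexPosition : ConvexPosition C
  lines : ∃ l₁ l₂ : ℝ, l₂ < l₁ ∧ (∀ p ∈ T₁, l₁ < p 1) ∧ (∀ p ∈ C, l₂ < p 1 ∧ p 1 < l₁) ∧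
    (∀ p ∈ T₂, p 1 < l₂)

/-- The vertices of the flip graph: multisets of `n` segments, each with two distinct endpoints,
both in `P` (that is, loopless multigraphs on `P` with `n` edges). -/
def Config (P : Finset Plane) (n : ℕ) : Type :=
  {S : Multiset (Sym2 Plane) //
    Multiset.card S = n ∧ ∀ s ∈ S, ¬ s.IsDiag ∧ ∀ p ∈ s, p ∈ P}

/-- `S'` arises from `S` by one flip: a crossing pair of segments `ab`, `cd` of `S` is replaced by
the non-crossing pair `ac`, `bd`, which has the same four endpoints and forms a cycle with the
removed pair. As segments are unordered, naming the endpoints of the removed pair in all possible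
ways gives both possible insertions. -/
def IsFlip (S S' : Multiset (Sym2 Plane)) : Prop :=
  ∃ (a b c d : Plane) (U : Multiset (Sym2 Plane)),
    S = s(a, b) ::ₘ s(c, d) ::ₘ U ∧ Crosses s(a, b) s(c, d) ∧
    S' = s(a, c) ::ₘ s(b, d) ::ₘ U ∧ ¬ Crosses s(a, c) s(b, d)

/-- The flip graph of multigraphs with `n` edges on `P`. -/
def flipGraph (P : Finset Plane) (n : ℕ) : Digraph (Config P n) where
  Adj S S' := IsFlip S.1 S'.1

/-- A sink of a directed graph: a vertex without outgoing arcs. -/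
def IsSink {V : Type*} (G : Digraph V) (v : V) : Prop := ∀ w, ¬ G.Adj v w

/-- A strategy for a flip graph `F`: a spanning subgraph with the same sinks. -/
def IsStrategy {V : Type*} (F R : Digraph V) : Prop :=
  R ≤ F ∧ ∀ v, IsSink R v ↔ IsSink F v

/-- A strategy for both removal and insertion choices: a strategy in which each vertex that is not
a sink of the flip graph has out-degree exactly one. -/
def IsRIStrategy {V : Type*} (F R : Digraph V) : Prop :=
  IsStrategy F R ∧ ∀ v, ¬ IsSink F v → ∃! w, R.Adj v w

/-- Flip sequences in a subgraph `R` of a flip graph: finite sequences of vertices, consecutive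
ones joined by arcs of `R`. The `length` of such a sequence is its number of arcs, `head` is its
first vertex and `last` its last one. -/
abbrev FlipSequence {V : Type*} (R : Digraph V) : Type _ :=
  RelSeries {e : V × V | R.Adj e.1 e.2}

/-- A flip sequence in a strategy for `F` is an untangle sequence if it ends in a sink of `F`. -/
def IsUntangle {V : Type*} (F : Digraph V) {R : Digraph V} (σ : FlipSequence R) : Prop :=
  IsSink F σ.last

open Classical in
/-- The sum of the degrees in the multigraph `S` of the points of `T₁ ∪ T₂`. -/
noncomputable def degreeSum (S : Multiset (Sym2 Plane)) (T₁ T₂ : Finset Plane) : ℕ :=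
  ∑ p ∈ T₁ ∪ T₂, S.countP (fun s => p ∈ s)

/-- The maximum over all separated point sets, of the minimum over all removal and insertion
strategies, of the length of the longest path of the strategy starting at a multigraph with `n`
edges in which the points outside `C` have total degree `t`. -/
noncomputable def dRI (n t : ℕ) : ℕ∞ :=
  ⨆ (P : Finset Plane) (C : Finset Plane) (T₁ : Finset Plane) (T₂ : Finset Plane)
    (_ : Separated P C T₁ T₂),
    ⨅ (RI : Digraph (Config P n)) (_ : IsRIStrategy (flipGraph P n) RI),
      ⨆ (σ : FlipSequence RI) (_ : degreeSum σ.head.1 T₁ T₂ = t), (σ.length : ℕ∞)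

end Untangle

open Untangle

/-! The strategy has two phases, controlled by one potential that drops at every flip.

While some crossed segment has an endpoint outside `C`, such a segment is flipped with one that
crosses it, joining the two lower and the two upper endpoints. Crossing segments overlap in height,
so this shortens the total height difference. Heights are measured by rank among the points in use,
which no flip changes, and segments inside `C` are charged nothing. Each charged segment uses up a
degree of `T`, so the total is at most `t` times the number of points in use, itself at most `|P|`
and at most `2n`. The horizontal lines ensure that the total still drops when one of the flipped
segments lies in `C` (`Separated.exists_flip_stretch`).

Afterwards all crossed segments lie in `C`. No point is in the hull of the other points of `C`,
hence a flip inside `C` makes no uncrossed segment crossed (`Crosses.crosses_of_flip`). Flipping a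
crossed segment that is shortest in the cyclic order, with a suitable partner, inserts an uncrossed
segment (`exists_flip_crossed`). The number of crossed segments, at most `n`, therefore drops, and
the first phase never resumes. -/

namespace Untangle

/-! ### Orientations and crossings. -/

/-- Twice the signed area of the triangle `abc`; positive when `a`, `b`, `c` turn left. -/
def orient (a b c : Plane) : ℝ :=
  (b 0 - a 0) * (c 1 - a 1) - (b 1 - a 1) * (c 0 - a 0)

lemma orient_rotate (a b c : Plane) : orient b c a = orient a b c := by
  unfold orient; ring

lemma orient_swap (a b c : Plane) : orient a c b = -orient a b c := by
  unfold orient; ring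

lemma orient_self_left (a b : Plane) : orient a b a = 0 := by
  unfold orient; ring

lemma orient_self_right (a b : Plane) : orient a b b = 0 := by
  unfold orient; ring

lemma orient_combination (p q a b : Plane) {u v : ℝ} (h : u + v = 1) :
    orient p q (u • a + v • b) = u * orient p q a + v * orient p q b := by
  obtain rfl : v = 1 - u := by linarith
  simp only [orient, PiLp.add_apply, PiLp.smul_apply, smul_eq_mul]
  ring

lemma plane_ext {a b : Plane} (h0 : a 0 = b 0) (h1 : a 1 = b 1) : a = b := by
  ext i
  fin_cases i
  · exact h0
  · exact h1

lemma eq_combination_of_orient_eq_zero {p q z : Plane} (hpq : p ≠ q) (h : orient p q z = 0) :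
    ∃ t : ℝ, z = (1 - t) • p + t • q := by
  unfold orient at h
  by_cases h0 : q 0 - p 0 = 0
  · have h1 : q 1 - p 1 ≠ 0 := by
      intro h1
      exact hpq (plane_ext (by linarith) (by linarith))
    have h2 : z 0 - p 0 = 0 := by
      rw [h0] at h
      have : (q 1 - p 1) * (z 0 - p 0) = 0 := by linarith
      exact (mul_eq_zero.1 this).resolve_left h1
    refine ⟨(z 1 - p 1) / (q 1 - p 1), plane_ext ?_ ?_⟩
    · simp only [PiLp.add_apply, PiLp.smul_apply, smul_eq_mul]
      rw [show q 0 = p 0 by linarith]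
      linarith
    · simp only [PiLp.add_apply, PiLp.smul_apply, smul_eq_mul]
      field_simp
      ring
  · refine ⟨(z 0 - p 0) / (q 0 - p 0), plane_ext ?_ ?_⟩
    · simp only [PiLp.add_apply, PiLp.smul_apply, smul_eq_mul]
      field_simp
      ring
    · simp only [PiLp.add_apply, PiLp.smul_apply, smul_eq_mul]
      field_simp
      linarith

lemma GeneralPosition.orient_ne_zero {P : Finset Plane} (hP : GeneralPosition P) {a b c : Plane}
    (ha : a ∈ P) (hb : b ∈ P) (hc : c ∈ P) (hab : a ≠ b) (hbc : b ≠ c) (hac : a ≠ c) :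
    orient a b c ≠ 0 := by
  intro h
  obtain ⟨t, ht⟩ := eq_combination_of_orient_eq_zero hab h
  refine hP a ha b hb c hc hab hbc hac ?_
  have hmem : c ∈ affineSpan ℝ {a, b} := by
    have := AffineMap.lineMap_mem_affineSpan_pair (k := ℝ) t a b
    rwa [AffineMap.lineMap_apply_module, ← ht] at this
  have := collinear_insert_of_mem_affineSpan_pair hmem
  rwa [Set.insert_comm, Set.pair_comm c b] at this

lemma Crosses.symm {s t : Sym2 Plane} (h : Crosses s t) : Crosses t s := by
  obtain ⟨x, hx, h1, h2⟩ := h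
  exact ⟨x, by rw [Set.inter_comm, hx], h2, h1⟩

lemma seg_mk (a b : Plane) : seg s(a, b) = segment ℝ a b := rfl

lemma Crosses.exists_combination {a b c d : Plane} (h : Crosses s(a, b) s(c, d)) :
    ∃ (x : Plane) (u v : ℝ), 0 < u ∧ u < 1 ∧ 0 < v ∧ v < 1 ∧
      x = (1 - u) • a + u • b ∧ x = (1 - v) • c + v • d := by
  obtain ⟨x, hx, h1, h2⟩ := h
  have hmem : x ∈ seg s(a, b) ∩ seg s(c, d) := by rw [hx]; rfl
  simp only [seg_mk] at hmem
  simp only [Sym2.mem_iff, not_or] at h1 h2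
  have key : ∀ p q : Plane, x ∈ segment ℝ p q → x ≠ p → x ≠ q →
      ∃ u : ℝ, 0 < u ∧ u < 1 ∧ x = (1 - u) • p + u • q := by
    intro p q hm hp hq
    obtain ⟨w, v, hw, hv, hwv, rfl⟩ := hm
    refine ⟨v, lt_of_le_of_ne hv ?_, ?_, ?_⟩
    · rintro rfl
      apply hp
      simp [show w = 1 by linarith]
    · refine lt_of_le_of_ne (by linarith) ?_
      rintro rfl
      apply hq
      simp [show w = 0 by linarith]
    · rw [show w = 1 - v by linarith]
  obtain ⟨u, hu0, hu1, hu⟩ := key a b hmem.1 h1.1 h1.2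
  obtain ⟨v, hv0, hv1, hv⟩ := key c d hmem.2 h2.1 h2.2
  exact ⟨x, u, v, hu0, hu1, hv0, hv1, hu, hv⟩

lemma Crosses.notMem_right {s t : Sym2 Plane} (h : Crosses s t) {p : Plane} (hp : p ∈ s) :
    p ∉ t := by
  intro hpt
  obtain ⟨x, hx, h1, -⟩ := h
  have hend : ∀ r : Sym2 Plane, p ∈ r → p ∈ seg r := by
    intro r hr
    induction r using Sym2.ind with
    | _ a b =>
      rw [seg_mk]
      rcases Sym2.mem_iff.1 hr with rfl | rfl
      · exact left_mem_segment ℝ _ _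
      · exact right_mem_segment ℝ _ _
  have : p ∈ ({x} : Set Plane) := by
    rw [← hx]
    exact ⟨hend s hp, hend t hpt⟩
  rw [Set.mem_singleton_iff] at this
  exact h1 (this ▸ hp)

lemma Crosses.ne {a b c d : Plane} (h : Crosses s(a, b) s(c, d)) :
    a ≠ c ∧ a ≠ d ∧ b ≠ c ∧ b ≠ d := by
  have h1 := h.notMem_right (Sym2.mem_mk_left a b)
  have h2 := h.notMem_right (Sym2.mem_mk_right a b)
  simp only [Sym2.mem_iff, not_or] at h1 h2
  exact ⟨h1.1, h1.2, h2.1, h2.2⟩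

lemma not_crosses_self (s : Sym2 Plane) : ¬ Crosses s s := by
  intro h
  induction s using Sym2.ind with
  | _ a b => exact h.ne.1 rfl

/-- Two segments of a point set in general position that meet and share no endpoint cross. -/
lemma GeneralPosition.crosses_of_mem {P : Finset Plane} (hP : GeneralPosition P)
    {a b c d x : Plane} (ha : a ∈ P) (hb : b ∈ P) (hc : c ∈ P) (hd : d ∈ P)
    (hab : a ≠ b) (hcd : c ≠ d) (hac : a ≠ c) (had : a ≠ d) (hbc : b ≠ c) (hbd : b ≠ d)
    (hx : x ∈ segment ℝ a b) (hx' : x ∈ segment ℝ c d) : Crosses s(a, b) s(c, d) := by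
  have hzero : ∀ p q y : Plane, y ∈ segment ℝ p q → orient p q y = 0 := by
    rintro p q y ⟨u, v, hu, hv, huv, rfl⟩
    rw [orient_combination _ _ _ _ huv, orient_self_left, orient_self_right]
    ring
  have h1 := hP.orient_ne_zero ha hb hc hab hbc hac
  have h2 := hP.orient_ne_zero ha hb hd hab hbd had
  have h3 := hP.orient_ne_zero hc hd ha hcd had.symm hac.symm
  have h4 := hP.orient_ne_zero hc hd hb hcd hbd.symm hbc.symm
  refine ⟨x, ?_, ?_, ?_⟩
  · simp only [seg_mk]
    refine Set.Subset.antisymm ?_ (Set.singleton_subset_iff.2 ⟨hx, hx'⟩)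
    rintro y ⟨hy, hy'⟩
    have e1 := hzero _ _ _ hx
    have e2 := hzero _ _ _ hy
    obtain ⟨u, v, hu, hv, huv, rfl⟩ := hx'
    obtain ⟨u', v', hu', hv', huv', rfl⟩ := hy'
    rw [orient_combination _ _ _ _ huv] at e1
    rw [orient_combination _ _ _ _ huv'] at e2
    obtain rfl : u = 1 - v := by linarith
    obtain rfl : u' = 1 - v' := by linarith
    -- Two distinct common points would put `c` and `d` on the line `ab`.
    have h5 : (v - v') * (orient a b d - orient a b c) = 0 := by linarith
    rcases mul_eq_zero.1 h5 with h | h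
    · rw [show v' = v by linarith]; rfl
    · exact absurd (show orient a b c = 0 by
        rw [show orient a b d = orient a b c by linarith] at e1; linarith) h1
  · rw [Sym2.mem_iff, not_or]
    constructor
    · rintro rfl; exact h3 (hzero _ _ _ hx')
    · rintro rfl; exact h4 (hzero _ _ _ hx')
  · rw [Sym2.mem_iff, not_or]
    constructor
    · rintro rfl; exact h1 (hzero _ _ _ hx)
    · rintro rfl; exact h2 (hzero _ _ _ hx)

lemma Crosses.orient_mul_neg {P : Finset Plane} (hP : GeneralPosition P)
    {a b c d : Plane} (ha : a ∈ P) (hb : b ∈ P) (hc : c ∈ P) (hab : a ≠ b)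
    (h : Crosses s(a, b) s(c, d)) : orient a b c * orient a b d < 0 := by
  obtain ⟨hac, -, hbc, -⟩ := h.ne
  have h1 := hP.orient_ne_zero ha hb hc hab hbc hac
  obtain ⟨x, u, v, hu0, hu1, hv0, hv1, hx, hx'⟩ := h.exists_combination
  have e1 : orient a b x = 0 := by
    rw [hx, orient_combination _ _ _ _ (by ring), orient_self_left, orient_self_right]; ring
  rw [hx', orient_combination _ _ _ _ (by ring)] at e1
  have h2 : v * (orient a b c * orient a b d) = -((1 - v) * (orient a b c * orient a b c)) := by
    linear_combination orient a b c * e1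
  have h3 : 0 < (1 - v) * (orient a b c * orient a b c) :=
    mul_pos (by linarith) (mul_self_pos.2 h1)
  by_contra hneg
  have := mul_nonneg hv0.le (not_lt.1 hneg)
  linarith

lemma GeneralPosition.crosses_of_orient {P : Finset Plane} (hP : GeneralPosition P)
    {a b c d : Plane} (ha : a ∈ P) (hb : b ∈ P) (hc : c ∈ P) (hd : d ∈ P)
    (h1 : orient a b c * orient a b d < 0) (h2 : orient c d a * orient c d b < 0) :
    Crosses s(a, b) s(c, d) := by
  have hne : ∀ p q r s : Plane, orient p q r * orient p q s < 0 →
      p ≠ q ∧ p ≠ r ∧ q ≠ r ∧ p ≠ s ∧ q ≠ s := by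
    intro p q r s h
    refine ⟨?_, ?_, ?_, ?_, ?_⟩ <;> rintro rfl <;> simp [orient, mul_comm] at h
  have key : ∀ u v : ℝ, u * v < 0 → 0 ≤ u / (u - v) ∧ u / (u - v) ≤ 1 ∧ u - v ≠ 0 := by
    intro u v h
    rcases mul_neg_iff.1 h with ⟨hu, hv⟩ | ⟨hu, hv⟩
    · exact ⟨div_nonneg hu.le (by linarith), (div_le_one (by linarith)).2 (by linarith),
        by linarith⟩
    · exact ⟨div_nonneg_of_nonpos hu.le (by linarith),
        (div_le_one_of_neg (by linarith)).2 (by linarith), by linarith⟩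
  obtain ⟨hab, hac, hbc, had, hbd⟩ := hne _ _ _ _ h1
  obtain ⟨hcd, -⟩ := hne _ _ _ _ h2
  obtain ⟨p0, p1, pne⟩ := key _ _ h2
  obtain ⟨q0, q1, qne⟩ := key _ _ h1
  -- Cramer's rule: each segment is divided in the ratio of the distances of its endpoints from the
  -- other line.
  set u := orient c d a / (orient c d a - orient c d b) with hu
  set v := orient a b c / (orient a b c - orient a b d) with hv
  refine hP.crosses_of_mem ha hb hc hd hab hcd hac had hbc hbd
    (x := (1 - u) • a + u • b) ⟨_, _, by linarith, p0, by ring, rfl⟩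
    ⟨1 - v, v, by linarith, q0, by ring, ?_⟩
  have hw : orient a b c - orient a b d = -(orient c d a - orient c d b) := by
    unfold orient; ring
  rw [hw] at hv
  have hu' : u * (orient c d a - orient c d b) = orient c d a := by rw [hu]; field_simp
  have hv' : v * (orient c d a - orient c d b) = -orient a b c := by rw [hv]; field_simp
  apply plane_ext <;> simp only [PiLp.add_apply, PiLp.smul_apply, smul_eq_mul] <;>
    apply mul_right_cancel₀ pne
  · have : -(d 0 - c 0) * orient a b c + (c 0 - a 0) * (orient c d a - orient c d b)
        - (b 0 - a 0) * orient c d a = 0 := by unfold orient; ring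
    linear_combination (d 0 - c 0) * hv' - (b 0 - a 0) * hu' + this
  · have : -(d 1 - c 1) * orient a b c + (c 1 - a 1) * (orient c d a - orient c d b)
        - (b 1 - a 1) * orient c d a = 0 := by unfold orient; ring
    linear_combination (d 1 - c 1) * hv' - (b 1 - a 1) * hu' + this

/-! ### How a flip affects crossings. -/

/-- Opposite sides of the quadrilateral spanned by two crossing segments do not cross. -/
lemma Crosses.not_crosses_flip {P : Finset Plane} (hP : GeneralPosition P)
    {a b c d : Plane} (ha : a ∈ P) (hb : b ∈ P) (hc : c ∈ P) (hd : d ∈ P)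
    (hab : a ≠ b) (hcd : c ≠ d) (h : Crosses s(a, b) s(c, d)) :
    ¬ Crosses s(a, c) s(b, d) := by
  intro h'
  have h1 := h.orient_mul_neg hP ha hb hc hab
  have h2 := h.symm.orient_mul_neg hP hc hd ha hcd
  have h3 := h'.orient_mul_neg hP ha hc hb h.ne.1
  -- Both pairs crossing would give `orient a b c`, `-orient a b d`, `orient c d a`, `-orient c d b`
  -- a common strict sign, yet they sum to zero.
  have e0 : orient a b c - orient a b d + orient c d a - orient c d b = 0 := by
    unfold orient; ring
  rw [orient_swap a b c, ← orient_rotate a c d] at h3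
  rcases mul_neg_iff.1 h1 with ⟨p, q⟩ | ⟨p, q⟩ <;> rcases mul_neg_iff.1 h2 with ⟨r, s⟩ | ⟨r, s⟩
  · linarith
  · linarith [mul_pos p (neg_pos.2 r)]
  · linarith [mul_pos (neg_pos.2 p) r]
  · linarith

/-- The line `pq` leaves the triangle `abc` through the part `ax` of `ab`, at a point `z`, besides
meeting `ac` at `y`. If `z` were not on the segment `pq`, then `p` or `q` would lie between `z` and
`y`, hence in the hull of `a`, `b`, `c`, which `hext` forbids. -/
lemma crosses_side_of_orient {P C : Finset Plane} (hP : GeneralPosition P) (hCP : C ⊆ P)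
    (hext : ∀ p ∈ P, p ∉ convexHull ℝ ((C : Set Plane) \ {p}))
    {a b c x y p q : Plane} (ha : a ∈ C) (hb : b ∈ C) (hc : c ∈ C) (hab : a ≠ b)
    (hp : p ∈ P) (hq : q ∈ P) (hpq : p ≠ q) {u : ℝ} (hu0 : 0 < u) (hu1 : u < 1)
    (hx : x = (1 - u) • a + u • b) (hy : y ∈ segment ℝ p q) (hy' : y ∈ segment ℝ a c)
    (hac : orient p q a * orient p q c < 0) (hax : orient p q a * orient p q x ≤ 0) :
    Crosses s(p, q) s(a, b) := by
  have hane : orient p q a ≠ 0 := left_ne_zero_of_mul hac.ne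
  have hcne : orient p q c ≠ 0 := right_ne_zero_of_mul hac.ne
  have hbne : orient p q b ≠ 0 := by
    intro h
    rw [hx, orient_combination _ _ _ _ (by ring), h] at hax
    have := mul_pos (sub_pos.2 hu1) (mul_self_pos.2 hane)
    nlinarith
  have hend : ∀ r, orient p q r ≠ 0 → p ≠ r ∧ q ≠ r := by
    intro r hr
    constructor <;> rintro rfl
    · exact hr (orient_self_left _ _)
    · exact hr (orient_self_right _ _)
  obtain ⟨hpa, hqa⟩ := hend a hane
  obtain ⟨hpb, hqb⟩ := hend b hbne
  obtain ⟨hpc, hqc⟩ := hend c hcne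
  obtain ⟨z, hz, hz0⟩ : ∃ z ∈ segment ℝ a b, orient p q z = 0 := by
    have hxm : x ∈ segment ℝ a b := ⟨1 - u, u, by linarith, hu0.le, by ring, hx.symm⟩
    have hl : 0 ≤ orient p q a / (orient p q a - orient p q x) ∧
        orient p q a / (orient p q a - orient p q x) ≤ 1 ∧ orient p q a - orient p q x ≠ 0 := by
      rcases lt_or_gt_of_ne hane with h | h
      · have : 0 ≤ orient p q x := by
          by_contra h'
          linarith [mul_pos_of_neg_of_neg h (not_le.1 h')]
        exact ⟨div_nonneg_of_nonpos h.le (by linarith),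
          (div_le_one_of_neg (by linarith)).2 (by linarith), by linarith⟩
      · have : orient p q x ≤ 0 := by
          by_contra h'
          linarith [mul_pos h (not_le.1 h')]
        exact ⟨div_nonneg h.le (by linarith),
          (div_le_one (by linarith)).2 (by linarith), by linarith⟩
    set l := orient p q a / (orient p q a - orient p q x) with hl'
    refine ⟨(1 - l) • a + l • x, ?_, ?_⟩
    · exact (convex_segment a b) (left_mem_segment ℝ a b) hxm (by linarith [hl.2.1]) hl.1 (by ring)
    · rw [orient_combination _ _ _ _ (by ring), hl']
      have := hl.2.2
      field_simp
      ring
  obtain ⟨t, ht⟩ := eq_combination_of_orient_eq_zero hpq hz0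
  have hull : ∀ r, r ≠ a → r ≠ b → r ≠ c → r ∈ segment ℝ z y →
      r ∈ convexHull ℝ ((C : Set Plane) \ {r}) := by
    intro r ra rb rc hr
    have ma : a ∈ convexHull ℝ ((C : Set Plane) \ {r}) := subset_convexHull _ _ ⟨ha, ra.symm⟩
    have mb : b ∈ convexHull ℝ ((C : Set Plane) \ {r}) := subset_convexHull _ _ ⟨hb, rb.symm⟩
    have mc : c ∈ convexHull ℝ ((C : Set Plane) \ {r}) := subset_convexHull _ _ ⟨hc, rc.symm⟩
    have hconv := convex_convexHull ℝ ((C : Set Plane) \ {r})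
    exact hconv.segment_subset (hconv.segment_subset ma mb hz) (hconv.segment_subset ma mc hy') hr
  obtain ⟨w, v, hw, hv, hwv, rfl⟩ := hy
  obtain rfl : w = 1 - v := by linarith
  rcases lt_or_ge t 0 with h0 | h0
  · refine absurd (hull p hpa hpb hpc
      ⟨v / (v - t), -t / (v - t), div_nonneg hv (by linarith),
        div_nonneg (by linarith) (by linarith), ?_, ?_⟩) (hext p hp)
    · have : v - t ≠ 0 := by linarith
      field_simp
      ring
    · have : v - t ≠ 0 := by linarith
      rw [ht]
      apply plane_ext <;> simp only [PiLp.add_apply, PiLp.smul_apply, smul_eq_mul] <;>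
        field_simp <;> ring
  rcases lt_or_ge 1 t with h1 | h1
  · refine absurd (hull q hqa hqb hqc
      ⟨(1 - v) / (t - v), (t - 1) / (t - v), div_nonneg hw (by linarith),
        div_nonneg (by linarith) (by linarith), ?_, ?_⟩) (hext q hq)
    · have : t - v ≠ 0 := by linarith
      field_simp
      ring
    · have : t - v ≠ 0 := by linarith
      rw [ht]
      apply plane_ext <;> simp only [PiLp.add_apply, PiLp.smul_apply, smul_eq_mul] <;>
        field_simp <;> ring
  exact hP.crosses_of_mem hp hq (hCP ha) (hCP hb) hpq hab hpa hpb hqa hqb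
    ⟨1 - t, t, by linarith, h0, by ring, ht.symm⟩ hz

/-- A flip of two segments with endpoints in `C` creates no new crossed segment, provided that no
point `p` lies in the convex hull of `C \ {p}`. -/
lemma Crosses.crosses_of_flip {P C : Finset Plane} (hP : GeneralPosition P) (hCP : C ⊆ P)
    (hext : ∀ p ∈ P, p ∉ convexHull ℝ ((C : Set Plane) \ {p}))
    {a b c d p q : Plane} (ha : a ∈ C) (hb : b ∈ C) (hc : c ∈ C) (hd : d ∈ C)
    (hab : a ≠ b) (hcd : c ≠ d) (hp : p ∈ P) (hq : q ∈ P) (hpq : p ≠ q)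
    (h : Crosses s(a, b) s(c, d)) (h' : Crosses s(p, q) s(a, c)) :
    Crosses s(p, q) s(a, b) ∨ Crosses s(p, q) s(c, d) := by
  have hneg := h'.orient_mul_neg hP hp hq (hCP ha) hpq
  obtain ⟨x, u, v, hu0, hu1, hv0, hv1, hx, hx'⟩ := h.exists_combination
  obtain ⟨y, r, s, hr0, hr1, hs0, hs1, hy, hy'⟩ := h'.exists_combination
  have my : y ∈ segment ℝ p q := ⟨1 - r, r, by linarith, hr0.le, by ring, hy.symm⟩
  have my' : y ∈ segment ℝ a c := ⟨1 - s, s, by linarith, hs0.le, by ring, hy'.symm⟩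
  -- The line `pq` separates `a` from `c`, so it also separates the crossing point `x` of `ab` and
  -- `cd` from one of them, unless `x` is on the line.
  rcases le_or_gt (orient p q a * orient p q x) 0 with hax | hax
  · exact Or.inl (crosses_side_of_orient hP hCP hext ha hb hc hab hp hq hpq hu0 hu1 hx my my'
      hneg hax)
  · refine Or.inr (crosses_side_of_orient hP hCP hext hc hd ha hcd hp hq hpq hv0 hv1 hx' my
      (segment_symm ℝ a c ▸ my') (by linarith) ?_)
    rcases mul_pos_iff.1 hax with ⟨h1, h2⟩ | ⟨h1, h2⟩ <;>
      rcases mul_neg_iff.1 hneg with ⟨h3, h4⟩ | ⟨h3, h4⟩ <;> nlinarith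


/-! ### Convex position and the cyclic order. -/

lemma Separated.subset {P C T₁ T₂ : Finset Plane} (h : Separated P C T₁ T₂) : C ⊆ P := by
  intro p hp
  have : p ∈ (P : Set Plane) := by rw [h.cover]; exact Or.inl (Or.inl hp)
  exact this

lemma Separated.mem_cases {P C T₁ T₂ : Finset Plane} (h : Separated P C T₁ T₂) {p : Plane}
    (hp : p ∈ P) : p ∈ C ∨ p ∈ T₁ ∨ p ∈ T₂ := by
  have : p ∈ (P : Set Plane) := hp
  rw [h.cover] at this
  rcases this with (h | h) | h
  exacts [Or.inl h, Or.inr (Or.inl h), Or.inr (Or.inr h)]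

/-- For `p` in `C` this is convex position; for the other points, one of the two lines bounds a
half-plane that contains `C` but not `p`. -/
lemma Separated.notMem_convexHull {P C T₁ T₂ : Finset Plane} (h : Separated P C T₁ T₂)
    {p : Plane} (hp : p ∈ P) : p ∉ convexHull ℝ ((C : Set Plane) \ {p}) := by
  obtain ⟨l₁, l₂, -, h₁, hC, h₂⟩ := h.lines
  have hlin : IsLinearMap ℝ (fun q : Plane => q 1) :=
    ⟨fun _ _ => by simp, fun _ _ => by simp⟩
  intro hmem
  rcases h.mem_cases hp with hp | hp | hp
  · exact convexIndependent_set_iff_notMem_convexHull_sdiff.1 h.convexPosition p hp hmem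
  · have hsub : convexHull ℝ ((C : Set Plane) \ {p}) ⊆ {q : Plane | q 1 < l₁} :=
      convexHull_min (fun q hq => (hC q hq.1).2) (convex_halfSpace_lt hlin l₁)
    have hlt : p 1 < l₁ := hsub hmem
    linarith [h₁ p hp]
  · have hsub : convexHull ℝ ((C : Set Plane) \ {p}) ⊆ {q : Plane | l₂ < q 1} :=
      convexHull_min (fun q hq => (hC q hq.1).1) (convex_halfSpace_gt hlin l₂)
    have hlt : l₂ < p 1 := hsub hmem
    linarith [h₂ p hp]

/-- In convex position, the orientation is a cyclic order. -/
lemma orient_pos_trans {P C : Finset Plane} (hP : GeneralPosition P) (hCP : C ⊆ P)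
    (hext : ∀ p ∈ P, p ∉ convexHull ℝ ((C : Set Plane) \ {p}))
    {a b c d : Plane} (ha : a ∈ C) (hb : b ∈ C) (hc : c ∈ C) (hd : d ∈ C)
    (h1 : 0 < orient a b c) (h2 : 0 < orient a c d) : 0 < orient a b d := by
  have hne : ∀ p q r : Plane, 0 < orient p q r → p ≠ q ∧ p ≠ r ∧ q ≠ r := by
    intro p q r h
    refine ⟨?_, ?_, ?_⟩ <;> rintro rfl <;> simp [orient, mul_comm] at h
  obtain ⟨hab, hac, -⟩ := hne _ _ _ h1
  obtain ⟨-, had, -⟩ := hne _ _ _ h2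
  have hbd : b ≠ d := by
    rintro rfl
    rw [orient_swap] at h2
    linarith
  by_contra hneg
  have h3 : orient a b d < 0 :=
    lt_of_le_of_ne (not_lt.1 hneg) (hP.orient_ne_zero (hCP ha) (hCP hb) (hCP hd) hab hbd had)
  -- Otherwise `a` lies in the triangle `bcd`: its barycentric coordinates are `orient a c d / D`,
  -- `-orient a b d / D` and `orient a b c / D`.
  set D := orient a c d - orient a b d + orient a b c with hD
  have hDpos : 0 < D := by linarith
  have mb : b ∈ convexHull ℝ ((C : Set Plane) \ {a}) := subset_convexHull _ _ ⟨hb, hab.symm⟩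
  have mc : c ∈ convexHull ℝ ((C : Set Plane) \ {a}) := subset_convexHull _ _ ⟨hc, hac.symm⟩
  have md : d ∈ convexHull ℝ ((C : Set Plane) \ {a}) := subset_convexHull _ _ ⟨hd, had.symm⟩
  have hconv := convex_convexHull ℝ ((C : Set Plane) \ {a})
  refine hext a (hCP ha) ?_
  have hE : 0 < orient a c d - orient a b d := by linarith
  have key := hconv (hconv mb mc (a := orient a c d / (orient a c d - orient a b d))
    (b := -orient a b d / (orient a c d - orient a b d)) (by positivity)
    (div_nonneg (by linarith) hE.le) (by field_simp; ring)) md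
    (a := (orient a c d - orient a b d) / D) (b := orient a b c / D)
    (by positivity) (by positivity) (by rw [← add_div, hD, div_self (by linarith)])
  convert key using 1
  have hD' : D ≠ 0 := hDpos.ne'
  apply plane_ext <;> simp only [PiLp.add_apply, PiLp.smul_apply, smul_eq_mul] <;>
    field_simp <;> rw [hD] <;> unfold orient <;> ring

/-- The points of a set in convex position can be numbered counterclockwise. -/
lemma exists_cyclic_position {P C : Finset Plane} (hP : GeneralPosition P) (hCP : C ⊆ P)
    (hext : ∀ p ∈ P, p ∉ convexHull ℝ ((C : Set Plane) \ {p})) :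
    ∃ pos : Plane → ℕ, Set.InjOn pos C ∧ ∀ a ∈ C, ∀ b ∈ C, ∀ c ∈ C,
      pos a < pos b → pos b < pos c → 0 < orient a b c := by
  classical
  rcases C.eq_empty_or_nonempty with rfl | ⟨o, ho⟩
  · exact ⟨fun _ => 0, by simp, by simp⟩
  -- The angular order around `o`, with `o` first; a point's position is its number of predecessors.
  let lt : Plane → Plane → Prop := fun p q => (p = o ∧ q ≠ o) ∨ (p ≠ o ∧ 0 < orient o p q)
  have lt_irrefl : ∀ p, ¬ lt p p := by
    rintro p (h | h)
    · exact h.2 h.1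
    · rw [orient_self_right] at h; exact lt_irrefl _ h.2
  have lt_trans : ∀ p ∈ C, ∀ q ∈ C, ∀ r ∈ C, lt p q → lt q r → lt p r := by
    intro p hp q hq r hr h1 h2
    rcases h1 with h1 | h1 <;> rcases h2 with h2 | h2
    · exact absurd h2.1 h1.2
    · refine Or.inl ⟨h1.1, ?_⟩
      rintro rfl
      rw [orient_self_left] at h2
      exact _root_.lt_irrefl _ h2.2
    · rw [h2.1, orient_self_left] at h1
      exact absurd h1.2 (_root_.lt_irrefl _)
    · exact Or.inr ⟨h1.1, orient_pos_trans hP hCP hext ho hp hq hr h1.2 h2.2⟩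
  have lt_total : ∀ p ∈ C, ∀ q ∈ C, p ≠ q → lt p q ∨ lt q p := by
    intro p hp q hq hpq
    by_cases h1 : p = o
    · exact Or.inl (Or.inl ⟨h1, fun h => hpq (h1.trans h.symm)⟩)
    by_cases h2 : q = o
    · exact Or.inr (Or.inl ⟨h2, h1⟩)
    rcases lt_or_gt_of_ne (hP.orient_ne_zero (hCP ho) (hCP hp) (hCP hq) (Ne.symm h1) hpq
      (Ne.symm h2)) with h | h
    · exact Or.inr (Or.inr ⟨h2, by rw [orient_swap]; linarith⟩)
    · exact Or.inl (Or.inr ⟨h1, h⟩)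
  have lt_orient : ∀ p ∈ C, ∀ q ∈ C, ∀ r ∈ C, lt p q → lt q r → 0 < orient p q r := by
    intro p hp q hq r hr h1 h2
    rcases h1 with h1 | h1 <;> rcases h2 with h2 | h2
    · exact absurd h2.1 h1.2
    · rw [h1.1]; exact h2.2
    · rw [h2.1, orient_self_left] at h1
      exact absurd h1.2 (_root_.lt_irrefl _)
    · rw [← orient_rotate]
      -- Transitivity is applied around `q`, from `r` through `o` to `p`.
      refine orient_pos_trans hP hCP hext hq hr ho hp ?_ ?_
      · rw [orient_rotate]; exact h2.2
      · rw [orient_rotate, orient_rotate]; exact h1.2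
  let pos : Plane → ℕ := fun p => (C.filter (fun q => lt q p)).card
  have pos_lt : ∀ p ∈ C, ∀ q ∈ C, lt p q → pos p < pos q := by
    intro p hp q hq h
    refine Finset.card_lt_card (Finset.ssubset_iff_of_subset ?_ |>.2 ⟨p, ?_, ?_⟩)
    · intro r hr
      rw [Finset.mem_filter] at hr ⊢
      exact ⟨hr.1, lt_trans r hr.1 p hp q hq hr.2 h⟩
    · exact Finset.mem_filter.2 ⟨hp, h⟩
    · exact fun h' => lt_irrefl p (Finset.mem_filter.1 h').2
  have lt_of_pos : ∀ p ∈ C, ∀ q ∈ C, pos p < pos q → lt p q := by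
    intro p hp q hq h
    rcases lt_total p hp q hq (by rintro rfl; exact Nat.lt_irrefl _ h) with h' | h'
    · exact h'
    · have := pos_lt q hq p hp h'
      omega
  refine ⟨pos, ?_, fun a ha b hb c hc hab hbc =>
    lt_orient a ha b hb c hc (lt_of_pos a ha b hb hab) (lt_of_pos b hb c hc hbc)⟩
  intro p hp q hq h
  by_contra hpq
  rcases lt_total p hp q hq hpq with h' | h'
  · have := pos_lt p hp q hq h'
    omega
  · have := pos_lt q hq p hp h'
    omega

/-! ### Flips inside `C`. -/

/-- A segment of `S` that is crossed by a segment of `S`. -/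
def CrossedIn (S : Multiset (Sym2 Plane)) (s : Sym2 Plane) : Prop := ∃ s' ∈ S, Crosses s s'

lemma exists_cons_cons {α : Type*} {S : Multiset α} {s t : α} (hs : s ∈ S) (ht : t ∈ S)
    (hne : s ≠ t) : ∃ U, S = s ::ₘ t ::ₘ U := by
  obtain ⟨S', rfl⟩ := Multiset.exists_cons_of_mem hs
  obtain ⟨U, rfl⟩ := Multiset.exists_cons_of_mem ((Multiset.mem_cons.1 ht).resolve_left hne.symm)
  exact ⟨U, rfl⟩

lemma exists_forall_le {α : Type*} (p : α → Prop) (f : α → ℕ) (h : ∃ a, p a) :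
    ∃ a, p a ∧ ∀ b, p b → f a ≤ f b := by
  obtain ⟨a, ha, hmin⟩ := (measure f).wf.has_min {a | p a} h
  exact ⟨a, ha, fun b hb => not_lt.1 (hmin b hb)⟩

lemma countP_le_countP {α : Type*} {p q : α → Prop} [DecidablePred p] [DecidablePred q]
    {S : Multiset α} (h : ∀ s ∈ S, p s → q s) : S.countP p ≤ S.countP q := by
  induction S using Multiset.induction_on with
  | empty => simp
  | cons a S ih =>
    have ih := ih fun s hs => h s (Multiset.mem_cons_of_mem hs)
    have ha := h a (Multiset.mem_cons_self a S)
    simp only [Multiset.countP_cons]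
    split_ifs <;> first | omega | tauto

open Classical in
/-- If all crossed segments have both endpoints in `C`, some flip decreases the number of crossed
segments. -/
lemma exists_flip_crossed {P C : Finset Plane} (hP : GeneralPosition P) (hCP : C ⊆ P)
    (hext : ∀ p ∈ P, p ∉ convexHull ℝ ((C : Set Plane) \ {p})) {S : Multiset (Sym2 Plane)}
    (hS : ∀ s ∈ S, ¬ s.IsDiag ∧ ∀ p ∈ s, p ∈ P)
    (hSC : ∀ s ∈ S, CrossedIn S s → ∀ p ∈ s, p ∈ C) (hcr : ∃ s ∈ S, CrossedIn S s) :
    ∃ S', IsFlip S S' ∧ (∀ s ∈ S', CrossedIn S' s → ∀ p ∈ s, p ∈ C) ∧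
      S'.countP (CrossedIn S') < S.countP (CrossedIn S) := by
  obtain ⟨pos, hinj, hpos⟩ := exists_cyclic_position hP hCP hext
  have pos_ne : ∀ a ∈ C, ∀ b ∈ C, a ≠ b → pos a ≠ pos b := fun a ha b hb hab h =>
    hab (hinj ha hb h)
  have hC : ∀ a b, s(a, b) ∈ S → CrossedIn S s(a, b) → a ∈ C ∧ b ∈ C ∧ pos a ≠ pos b := by
    intro a b hm hc
    have ha := hSC _ hm hc a (Sym2.mem_mk_left a b)
    have hb := hSC _ hm hc b (Sym2.mem_mk_right a b)
    exact ⟨ha, hb, pos_ne a ha b hb (by simpa using (hS _ hm).1)⟩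
  have side : ∀ a ∈ C, ∀ b ∈ C, ∀ c ∈ C, pos a < pos b →
      (pos a < pos c → pos c < pos b → orient a b c < 0) ∧
      (pos c < pos a ∨ pos b < pos c → 0 < orient a b c) := by
    intro a ha b hb c hc hab
    refine ⟨fun h1 h2 => ?_, ?_⟩
    · have := hpos a ha c hc b hb h1 h2
      rw [orient_swap] at this
      linarith
    · rintro (h | h)
      · have := hpos c hc a ha b hb h hab
        rwa [← orient_rotate] at this
      · exact hpos a ha b hb c hc hab h
  have interleave : ∀ a ∈ C, ∀ b ∈ C, ∀ c ∈ C, ∀ d ∈ C, pos a < pos b →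
      Crosses s(a, b) s(c, d) →
      (pos a < pos c ∧ pos c < pos b ∧ (pos d < pos a ∨ pos b < pos d)) ∨
      (pos a < pos d ∧ pos d < pos b ∧ (pos c < pos a ∨ pos b < pos c)) := by
    intro a ha b hb c hc d hd hab h
    have hneg := h.orient_mul_neg hP (hCP ha) (hCP hb) (hCP hc) (by rintro rfl; omega)
    obtain ⟨hac, had, hbc, hbd⟩ := h.ne
    have n1 := pos_ne a ha c hc hac
    have n2 := pos_ne a ha d hd had
    have n3 := pos_ne b hb c hc hbc
    have n4 := pos_ne b hb d hd hbd
    obtain ⟨c1, c2⟩ := side a ha b hb c hc hab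
    obtain ⟨d1, d2⟩ := side a ha b hb d hd hab
    by_cases hcin : pos a < pos c ∧ pos c < pos b <;>
      by_cases hdin : pos a < pos d ∧ pos d < pos b
    · exact absurd hneg (not_lt.2 (mul_pos_of_neg_of_neg (c1 hcin.1 hcin.2)
        (d1 hdin.1 hdin.2)).le)
    · omega
    · omega
    · exact absurd hneg (not_lt.2 (mul_pos (c2 (by omega)) (d2 (by omega))).le)
  have crosses_of : ∀ a ∈ C, ∀ b ∈ C, ∀ c ∈ C, ∀ d ∈ C, pos a < pos c → pos c < pos b →
      (pos d < pos a ∨ pos b < pos d) → Crosses s(a, b) s(c, d) := by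
    intro a ha b hb c hc d hd h1 h2 h3
    have hneg := mul_neg_of_neg_of_pos ((side a ha b hb c hc (by omega)).1 h1 h2)
      ((side a ha b hb d hd (by omega)).2 h3)
    refine hP.crosses_of_orient (hCP ha) (hCP hb) (hCP hc) (hCP hd) hneg ?_
    rcases h3 with h3 | h3
    · have e1 := (side d hd c hc a ha (by omega)).1 h3 h1
      have e2 := (side d hd c hc b hb (by omega)).2 (Or.inr h2)
      have r : ∀ x, orient c d x = -orient d c x := fun x => by unfold orient; ring
      rw [r a, r b]
      nlinarith
    · have e1 := (side c hc d hd a ha (by omega)).2 (Or.inl h1)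
      have e2 := (side c hc d hd b hb (by omega)).1 h2 h3
      exact mul_neg_of_pos_of_neg e1 e2
  -- A crossed segment `ab` with the smallest gap between the positions of its endpoints.
  obtain ⟨⟨a, b⟩, ⟨hab, habS, habC⟩, hmin⟩ := exists_forall_le
    (fun x : Plane × Plane => pos x.1 < pos x.2 ∧ s(x.1, x.2) ∈ S ∧ CrossedIn S s(x.1, x.2))
    (fun x => pos x.2 - pos x.1) (by
      obtain ⟨s, hs, hc⟩ := hcr
      induction s using Sym2.ind with
      | _ a b =>
        rcases lt_or_gt_of_ne (hC a b hs hc).2.2 with h | h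
        · exact ⟨(a, b), h, hs, hc⟩
        · exact ⟨(b, a), h, Sym2.eq_swap ▸ hs, Sym2.eq_swap ▸ hc⟩)
  dsimp only at hab habS habC hmin
  obtain ⟨ha, hb, -⟩ := hC a b habS habC
  -- Among the segments crossing `ab`, one whose endpoint `c` between `a` and `b` comes first after
  -- `a`.
  obtain ⟨⟨c, d⟩, ⟨hac, hcb, hcdS, hcr'⟩, hmin'⟩ := exists_forall_le
    (fun x : Plane × Plane => pos a < pos x.1 ∧ pos x.1 < pos b ∧ s(x.1, x.2) ∈ S ∧
      Crosses s(a, b) s(x.1, x.2)) (fun x => pos x.1) (by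
      obtain ⟨s, hs, hc⟩ := habC
      induction s using Sym2.ind with
      | _ c d =>
        obtain ⟨hcC, hdC, -⟩ := hC c d hs ⟨_, habS, hc.symm⟩
        rcases interleave a ha b hb c hcC d hdC hab hc with h | h
        · exact ⟨(c, d), h.1, h.2.1, hs, hc⟩
        · rw [Sym2.eq_swap (a := c)] at hs hc
          exact ⟨(d, c), h.1, h.2.1, hs, hc⟩)
  dsimp only at hac hcb hcdS hcr' hmin'
  have hcdC : CrossedIn S s(c, d) := ⟨_, habS, hcr'.symm⟩
  obtain ⟨hc, hd, -⟩ := hC c d hcdS hcdC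
  have hdout : pos d < pos a ∨ pos b < pos d := by
    rcases interleave a ha b hb c hc d hd hab hcr' with h | h <;> omega
  have hab' : a ≠ b := by rintro rfl; omega
  have hcd' : c ≠ d := by rintro rfl; omega
  obtain ⟨U, hU⟩ := exists_cons_cons habS hcdS (fun h => not_crosses_self _ (h ▸ hcr'))
  have hUS : ∀ s ∈ U, s ∈ S := fun s hs => by rw [hU]; simp [hs]
  have hflip : ¬ Crosses s(a, c) s(b, d) :=
    hcr'.not_crosses_flip hP (hCP ha) (hCP hb) (hCP hc) (hCP hd) hab' hcd'
  have old_ac : ∀ s ∈ U, Crosses s s(a, c) → CrossedIn S s := by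
    intro s hs h
    induction s using Sym2.ind with
    | _ p q =>
      obtain ⟨hdiag, hmem⟩ := hS _ (hUS _ hs)
      rcases hcr'.crosses_of_flip hP hCP hext ha hb hc hd hab' hcd' (hmem p (by simp))
        (hmem q (by simp)) (by simpa using hdiag) h with h | h
      exacts [⟨_, habS, h⟩, ⟨_, hcdS, h⟩]
  have old_bd : ∀ s ∈ U, Crosses s s(b, d) → CrossedIn S s := by
    intro s hs h
    induction s using Sym2.ind with
    | _ p q =>
      obtain ⟨hdiag, hmem⟩ := hS _ (hUS _ hs)
      have hcr'' : Crosses s(b, a) s(d, c) := by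
        rwa [Sym2.eq_swap (a := b), Sym2.eq_swap (a := d)]
      rcases hcr''.crosses_of_flip hP hCP hext hb ha hd hc hab'.symm hcd'.symm
        (hmem p (by simp)) (hmem q (by simp)) (by simpa using hdiag) h with h | h
      · exact ⟨_, habS, by rwa [Sym2.eq_swap (a := a)]⟩
      · exact ⟨_, hcdS, by rwa [Sym2.eq_swap (a := c)]⟩
  have old : ∀ s ∈ U, CrossedIn (s(a, c) ::ₘ s(b, d) ::ₘ U) s → CrossedIn S s := by
    rintro s hs ⟨s', hs', h⟩
    simp only [Multiset.mem_cons] at hs'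
    rcases hs' with rfl | rfl | hs'
    exacts [old_ac s hs h, old_bd s hs h, ⟨s', hUS s' hs', h⟩]
  -- A segment `ef` crossing `ac`, with `e` between `a` and `c`, was crossed before the flip. If `f`
  -- lies beyond `a` or `b`, then `ef` crosses `ab` and `e` contradicts the choice of `c`; otherwise
  -- `ef` has a smaller gap than `ab`.
  have new : ¬ CrossedIn (s(a, c) ::ₘ s(b, d) ::ₘ U) s(a, c) := by
    rintro ⟨s, hs, h⟩
    simp only [Multiset.mem_cons] at hs
    rcases hs with rfl | rfl | hs
    · exact not_crosses_self _ h
    · exact hflip h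
    have hsC := old_ac s hs h.symm
    have main : ∀ e f, s = s(e, f) → pos a < pos e → pos e < pos c →
        (pos f < pos a ∨ pos c < pos f) → False := by
      rintro e f rfl h1 h2 h3
      have hefS := hUS _ hs
      obtain ⟨he, hf, -⟩ := hC e f hefS hsC
      by_cases hin : pos f < pos a ∨ pos b < pos f
      · have := hmin' (e, f) ⟨h1, by dsimp only; omega, hefS,
          crosses_of a ha b hb e he f hf h1 (by omega) hin⟩
        dsimp only at this
        omega
      · have := hmin (e, f) ⟨by dsimp only; omega, hefS, hsC⟩
        dsimp only at this
        omega
    induction s using Sym2.ind with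
    | _ e f =>
      obtain ⟨he, hf, -⟩ := hC e f (hUS _ hs) hsC
      rcases interleave a ha c hc e he f hf hac h with h' | h'
      · exact main e f rfl h'.1 h'.2.1 h'.2.2
      · exact main f e Sym2.eq_swap h'.1 h'.2.1 h'.2.2
  refine ⟨s(a, c) ::ₘ s(b, d) ::ₘ U, ⟨a, b, c, d, U, hU, hcr', rfl, hflip⟩, ?_, ?_⟩
  · intro s hs hc'
    simp only [Multiset.mem_cons] at hs
    rcases hs with rfl | rfl | hs
    · exact absurd hc' new
    · intro p hp
      rcases Sym2.mem_iff.1 hp with rfl | rfl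
      exacts [hb, hd]
    · exact hSC s (hUS s hs) (old s hs hc')
  · have hle : U.countP (CrossedIn (s(a, c) ::ₘ s(b, d) ::ₘ U)) ≤ U.countP (CrossedIn S) :=
      countP_le_countP old
    -- Two crossed segments leave, and of the inserted ones only `bd` can be crossed.
    have h2 : S.countP (CrossedIn S) = U.countP (CrossedIn S) + 2 := by
      have : ∀ p : Sym2 Plane → Prop, p s(a, b) → p s(c, d) →
          S.countP p = U.countP p + 2 := by
        intro p h1 h2
        rw [hU, Multiset.countP_cons_of_pos _ h1, Multiset.countP_cons_of_pos _ h2]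
      exact this _ habC hcdC
    rw [h2, Multiset.countP_cons_of_neg _ new, Multiset.countP_cons]
    split_ifs <;> omega


/-! ### Flips that shorten the total stretch. -/

lemma Crosses.height_lt {a b c d : Plane} (hab : a 1 < b 1) (hcd : c 1 < d 1)
    (h : Crosses s(a, b) s(c, d)) : a 1 < d 1 ∧ c 1 < b 1 := by
  obtain ⟨x, u, v, hu0, hu1, hv0, hv1, hx, hx'⟩ := h.exists_combination
  have e1 : x 1 = (1 - u) * a 1 + u * b 1 := by rw [hx]; simp
  have e2 : x 1 = (1 - v) * c 1 + v * d 1 := by rw [hx']; simp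
  have m1 := mul_pos hu0 (sub_pos.2 hab)
  have m2 := mul_pos (sub_pos.2 hu1) (sub_pos.2 hab)
  have m3 := mul_pos hv0 (sub_pos.2 hcd)
  have m4 := mul_pos (sub_pos.2 hv1) (sub_pos.2 hcd)
  constructor <;> linarith

/-- The number of points of `A` below `p`. -/
noncomputable def rank (A : Finset Plane) (p : Plane) : ℕ := (A.filter (fun q => q 1 < p 1)).card

lemma rank_le_card (A : Finset Plane) (p : Plane) : rank A p ≤ A.card :=
  Finset.card_filter_le _ _

lemma rank_lt {A : Finset Plane} {p q : Plane} (hp : p ∈ A) (h : p 1 < q 1) :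
    rank A p < rank A q := by
  refine Finset.card_lt_card (Finset.ssubset_iff_of_subset ?_ |>.2 ⟨p, ?_, ?_⟩)
  · intro r hr
    rw [Finset.mem_filter] at hr ⊢
    exact ⟨hr.1, hr.2.trans h⟩
  · exact Finset.mem_filter.2 ⟨hp, h⟩
  · exact fun h' => lt_irrefl _ (Finset.mem_filter.1 h').2

open Classical in
/-- The difference of the ranks of the endpoints of a segment, or `0` if both lie in `C`. -/
noncomputable def stretch (C A : Finset Plane) : Sym2 Plane → ℕ :=
  Sym2.lift ⟨fun a b => if a ∈ C ∧ b ∈ C then 0 else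
    (rank A a - rank A b) + (rank A b - rank A a), fun a b => by
      simp only [and_comm, Nat.add_comm]⟩

open Classical in
lemma stretch_mk (C A : Finset Plane) (a b : Plane) : stretch C A s(a, b) =
    if a ∈ C ∧ b ∈ C then 0 else (rank A a - rank A b) + (rank A b - rank A a) := rfl

/-- The three strips as levels 0, 1, 2, with `C` the middle one, so that membership in `C` and its
effect on heights become integer arithmetic. -/
lemma Separated.exists_level {P C T₁ T₂ : Finset Plane} (h : Separated P C T₁ T₂) :
    ∃ lev : Plane → ℕ, (∀ p ∈ P, lev p ≤ 2 ∧ (p ∈ C ↔ lev p = 1)) ∧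
      ∀ p ∈ P, ∀ q ∈ P, lev p < lev q → p 1 < q 1 := by
  obtain ⟨l₁, l₂, hl, h₁, hC, h₂⟩ := h.lines
  classical
  refine ⟨fun p => if p 1 < l₂ then 0 else if p 1 < l₁ then 1 else 2, ?_, ?_⟩
  · intro p hp
    refine ⟨by dsimp only; split_ifs <;> omega, ?_⟩
    have key : p ∈ C ↔ ¬ p 1 < l₂ ∧ p 1 < l₁ := by
      refine ⟨fun hc => ⟨(hC p hc).1.le.not_gt, (hC p hc).2⟩, fun hc => ?_⟩
      rcases h.mem_cases hp with hp | hp | hp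
      · exact hp
      · linarith [h₁ p hp]
      · exact absurd (h₂ p hp) hc.1
    rw [key]
    dsimp only
    split_ifs <;> simp_all
  · intro p _ q _ hlt
    dsimp only at hlt
    split_ifs at hlt <;> first | omega | linarith

/-- A flip of a crossing pair of segments, not all of whose endpoints lie in `C`, that joins the two
lower endpoints and the two upper endpoints decreases the total stretch. -/
lemma Separated.exists_flip_stretch {P C T₁ T₂ : Finset Plane} (h : Separated P C T₁ T₂)
    {S : Multiset (Sym2 Plane)} (hS : ∀ s ∈ S, ¬ s.IsDiag ∧ ∀ p ∈ s, p ∈ P) {A : Finset Plane}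
    (hA : ∀ s ∈ S, ∀ p ∈ s, p ∈ A) {s s' : Sym2 Plane} (hs : s ∈ S) (hs' : s' ∈ S)
    (hcr : Crosses s s') (hsC : ¬ ∀ p ∈ s, p ∈ C) :
    ∃ S', IsFlip S S' ∧ (S'.map (stretch C A)).sum < (S.map (stretch C A)).sum := by
  have hsort : ∀ r ∈ S, ∃ a b, r = s(a, b) ∧ a 1 < b 1 := by
    intro r hr
    obtain ⟨hd, hm⟩ := hS r hr
    induction r using Sym2.ind with
    | _ a b =>
      have hne : a 1 ≠ b 1 := fun he =>
        hd (h.distinct_heights (hm a (by simp)) (hm b (by simp)) he)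
      rcases lt_or_gt_of_ne hne with hlt | hlt
      · exact ⟨a, b, rfl, hlt⟩
      · exact ⟨b, a, Sym2.eq_swap, hlt⟩
  obtain ⟨a, b, rfl, hab⟩ := hsort s hs
  obtain ⟨c, d, rfl, hcd⟩ := hsort s' hs'
  have ha := (hS _ hs).2 a (by simp)
  have hb := (hS _ hs).2 b (by simp)
  have hc := (hS _ hs').2 c (by simp)
  have hd := (hS _ hs').2 d (by simp)
  have haA := hA _ hs a (by simp)
  have hbA := hA _ hs b (by simp)
  have hcA := hA _ hs' c (by simp)
  have hdA := hA _ hs' d (by simp)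
  obtain ⟨had, hcb⟩ := hcr.height_lt hab hcd
  obtain ⟨U, hU⟩ := exists_cons_cons hs hs' (fun he => not_crosses_self _ (he ▸ hcr))
  refine ⟨s(a, c) ::ₘ s(b, d) ::ₘ U, ⟨a, b, c, d, U, hU, hcr, rfl,
    hcr.not_crosses_flip h.generalPosition ha hb hc hd (by rintro rfl; exact lt_irrefl _ hab)
      (by rintro rfl; exact lt_irrefl _ hcd)⟩, ?_⟩
  obtain ⟨lev, hlev, hmono⟩ := h.exists_level
  -- Without the exemption for `C`, the sum of rank differences drops by twice the overlap of the
  -- two rank intervals. If `cd` is exempt, its crossing with `ab` forces `a` and `b` into different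
  -- strips. Either they are below and above `C`, and `ac`, `bd` have disjoint rank intervals inside
  -- that of `ab`; or one is in `C`, so one inserted segment is exempt and the other has smaller
  -- stretch than `ab`.
  simp only [hU, Multiset.map_cons, Multiset.sum_cons, ← Nat.add_assoc, Nat.add_lt_add_iff_right]
  simp only [Sym2.mem_iff, forall_eq_or_imp, forall_eq] at hsC
  obtain ⟨la, hla⟩ := hlev a ha
  obtain ⟨lb, hlb⟩ := hlev b hb
  obtain ⟨lc, hlc⟩ := hlev c hc
  obtain ⟨ld, hld⟩ := hlev d hd
  have r1 := rank_lt haA hab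
  have r2 := rank_lt hcA hcd
  have r3 := rank_lt haA had
  have r4 := rank_lt hcA hcb
  have le_of : ∀ p ∈ P, ∀ q ∈ P, p 1 < q 1 → lev p ≤ lev q := fun p hp q hq hpq =>
    not_lt.1 fun hlt => lt_asymm hpq (hmono q hq p hp hlt)
  have l1 := le_of a ha b hb hab
  have l2 := le_of c hc d hd hcd
  have l3 := le_of a ha d hd had
  have l4 := le_of c hc b hb hcb
  have m1 : lev a < lev c → rank A a < rank A c := fun hl => rank_lt haA (hmono a ha c hc hl)
  have m2 : lev c < lev a → rank A c < rank A a := fun hl => rank_lt hcA (hmono c hc a ha hl)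
  have m3 : lev b < lev d → rank A b < rank A d := fun hl => rank_lt hbA (hmono b hb d hd hl)
  have m4 : lev d < lev b → rank A d < rank A b := fun hl => rank_lt hdA (hmono d hd b hb hl)
  simp only [stretch_mk, hla, hlb, hlc, hld] at hsC ⊢
  clear le_of hmono hlev hA hS hsort
  split_ifs <;> omega

/-! ### Points in use and the bound on the stretch. -/

open Classical in
/-- The endpoints of the segments of `S`. -/
noncomputable def active (S : Multiset (Sym2 Plane)) : Finset Plane :=
  S.toFinset.biUnion Sym2.toFinset

lemma mem_active {S : Multiset (Sym2 Plane)} {p : Plane} : p ∈ active S ↔ ∃ s ∈ S, p ∈ s := by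
  simp [active]

lemma IsFlip.active_eq {S S' : Multiset (Sym2 Plane)} (h : IsFlip S S') :
    active S' = active S := by
  obtain ⟨a, b, c, d, U, rfl, -, rfl, -⟩ := h
  ext p
  simp only [mem_active, Multiset.mem_cons, exists_eq_or_imp, Sym2.mem_iff]
  tauto

lemma card_active_le (S : Multiset (Sym2 Plane)) : (active S).card ≤ 2 * Multiset.card S := by
  classical
  calc (active S).card ≤ S.toFinset.card * 2 := by
        refine Finset.card_biUnion_le_card_mul _ _ _ fun s _ => ?_
        induction s using Sym2.ind with
        | _ a b =>
          rw [Sym2.toFinset_mk_eq]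
          exact Finset.card_le_two
    _ ≤ 2 * Multiset.card S := by
        have := S.toFinset_card_le
        omega

lemma IsFlip.isConfig {P : Finset Plane} {n : ℕ} {S S' : Multiset (Sym2 Plane)} (h : IsFlip S S')
    (hS : Multiset.card S = n ∧ ∀ s ∈ S, ¬ s.IsDiag ∧ ∀ p ∈ s, p ∈ P) :
    Multiset.card S' = n ∧ ∀ s ∈ S', ¬ s.IsDiag ∧ ∀ p ∈ s, p ∈ P := by
  obtain ⟨a, b, c, d, U, rfl, hcr, rfl, -⟩ := h
  obtain ⟨hac, -, -, hbd⟩ := hcr.ne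
  refine ⟨by simpa using hS.1, ?_⟩
  have hS := hS.2
  simp only [Multiset.mem_cons, forall_eq_or_imp, Sym2.mem_iff, forall_eq, Sym2.mk_isDiag_iff]
    at hS ⊢
  tauto

/-- A segment that is not exempt has an endpoint in `T₁ ∪ T₂`, so it adds at least 1 to the degree
sum and at most `A.card` to the stretch. -/
lemma sum_stretch_le {P C T₁ T₂ : Finset Plane} (h : Separated P C T₁ T₂)
    {S : Multiset (Sym2 Plane)} (hS : ∀ s ∈ S, ∀ p ∈ s, p ∈ P) (A : Finset Plane) :
    (S.map (stretch C A)).sum ≤ degreeSum S T₁ T₂ * A.card := by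
  classical
  induction S using Multiset.induction_on with
  | empty => simp
  | cons s S ih =>
    have ih := ih fun s hs => hS s (Multiset.mem_cons_of_mem hs)
    have hs := hS s (Multiset.mem_cons_self s S)
    have hdeg : degreeSum (s ::ₘ S) T₁ T₂ =
        degreeSum S T₁ T₂ + ((T₁ ∪ T₂).filter (fun p => p ∈ s)).card := by
      simp only [degreeSum, Multiset.countP_cons, Finset.sum_add_distrib, Finset.card_filter]
    rw [Multiset.map_cons, Multiset.sum_cons, hdeg, Nat.add_mul, Nat.add_comm]
    refine Nat.add_le_add ih ?_
    induction s using Sym2.ind with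
    | _ a b =>
      rw [stretch_mk]
      split_ifs with hC
      · exact Nat.zero_le _
      · have hpos : 0 < ((T₁ ∪ T₂).filter (fun p => p ∈ s(a, b))).card := by
          have hT : ∀ p ∈ s(a, b), p ∉ C →
              0 < ((T₁ ∪ T₂).filter (fun p => p ∈ s(a, b))).card := by
            intro p hp hpC
            refine Finset.card_pos.2 ⟨p, Finset.mem_filter.2 ⟨?_, hp⟩⟩
            rw [Finset.mem_union]
            exact (h.mem_cases (hs p hp)).resolve_left hpC
          by_cases haC : a ∈ C
          · exact hT b (by simp) fun hb => hC ⟨haC, hb⟩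
          · exact hT a (by simp) haC
        have h1 := rank_le_card A a
        have h2 := rank_le_card A b
        calc _ ≤ 1 * A.card := by omega
          _ ≤ _ := Nat.mul_le_mul_right _ hpos

/-! ### From a potential to a strategy. -/

/-- If every vertex that is not a sink has a successor of smaller potential, then some strategy
has all its flip sequences bounded by the potential of their first vertex. -/
lemma exists_strategy_of_potential {V : Type*} (F : Digraph V) (μ : V → ℕ)
    (h : ∀ v, ¬ IsSink F v → ∃ w, F.Adj v w ∧ μ w < μ v) :
    ∃ R : Digraph V, IsRIStrategy F R ∧
      (∀ v, ∃ σ : FlipSequence R, σ.head = v ∧ IsUntangle F σ) ∧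
      ∀ σ : FlipSequence R, σ.length ≤ μ σ.head := by
  choose f hf hμ using h
  let R : Digraph V := ⟨fun v w => ∃ hv : ¬ IsSink F v, w = f v hv⟩
  have hR : ∀ v, ∀ hv : ¬ IsSink F v, R.Adj v (f v hv) := fun v hv => ⟨hv, rfl⟩
  refine ⟨R, ⟨⟨?_, fun v => ⟨fun hv => ?_, fun hv w hw => ?_⟩⟩, fun v hv => ?_⟩, ?_, ?_⟩
  · rintro v w ⟨hv, rfl⟩
    exact hf v hv
  · by_contra hv'
    exact hv _ (hR v hv')
  · obtain ⟨hv', -⟩ := hw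
    exact hv' hv
  · exact ⟨f v hv, hR v hv, fun w ⟨_, hw⟩ => hw⟩
  · intro v
    induction hk : μ v using Nat.strong_induction_on generalizing v with
    | _ k ih =>
      by_cases hv : IsSink F v
      · refine ⟨RelSeries.singleton _ v, RelSeries.head_singleton v, ?_⟩
        rw [IsUntangle, RelSeries.last_singleton]
        exact hv
      · obtain ⟨σ, hσ, hσ'⟩ := ih _ (hk ▸ hμ v hv) (f v hv) rfl
        refine ⟨σ.cons v (by rw [hσ]; exact hR v hv), RelSeries.head_cons _ _ _, ?_⟩
        rw [IsUntangle, RelSeries.last_cons]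
        exact hσ'
  · intro σ
    -- Each arc lowers the potential by at least 1.
    have key : ∀ i : ℕ, ∀ hi : i < σ.length + 1, μ (σ ⟨i, hi⟩) + i ≤ μ σ.head := by
      intro i
      induction i with
      | zero => intro hi; exact le_refl _
      | succ i ih =>
        intro hi
        have h1 := ih (by omega)
        have h2 : R.Adj (σ ⟨i, by omega⟩) (σ ⟨i + 1, hi⟩) := σ.step ⟨i, by omega⟩
        obtain ⟨hv, hw⟩ := h2
        have h3 := hμ _ hv
        rw [← hw] at h3
        omega
    have := key σ.length (by omega)
    omega

/-! ### Combining the two phases. -/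

open Classical in
/-- The potential that decreases along the strategy. -/
noncomputable def potential (C : Finset Plane) (n : ℕ) (S : Multiset (Sym2 Plane)) : ℕ :=
  if ∃ s ∈ S, CrossedIn S s ∧ ¬ ∀ p ∈ s, p ∈ C then (S.map (stretch C (active S))).sum + n
  else S.countP (CrossedIn S)

/-- The summand `n` in the first phase pays for the second. This bound holds in both phases, so the
potential also drops at the flip that ends the first phase. -/
lemma potential_le {C : Finset Plane} {n : ℕ} {S : Multiset (Sym2 Plane)}
    (hS : Multiset.card S = n) : potential C n S ≤ (S.map (stretch C (active S))).sum + n := by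
  classical
  rw [potential]
  split_ifs
  · exact le_refl _
  · have := Multiset.countP_le_card (CrossedIn S) S
    omega

lemma Separated.exists_flip_potential {P C T₁ T₂ : Finset Plane} (h : Separated P C T₁ T₂) {n : ℕ}
    {S : Multiset (Sym2 Plane)}
    (hS : Multiset.card S = n ∧ ∀ s ∈ S, ¬ s.IsDiag ∧ ∀ p ∈ s, p ∈ P)
    (hcr : ∃ s ∈ S, CrossedIn S s) : ∃ S', IsFlip S S' ∧ potential C n S' < potential C n S := by
  by_cases hphase : ∃ s ∈ S, CrossedIn S s ∧ ¬ ∀ p ∈ s, p ∈ C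
  · obtain ⟨s, hs, ⟨s', hs', hss'⟩, hsC⟩ := id hphase
    obtain ⟨S', hflip, hlt⟩ := h.exists_flip_stretch hS.2
      (fun s hs p hp => mem_active.2 ⟨s, hs, hp⟩) hs hs' hss' hsC
    refine ⟨S', hflip, ?_⟩
    have h1 := potential_le (C := C) (hflip.isConfig hS).1
    rw [hflip.active_eq] at h1
    rw [potential.eq_def C n S, if_pos hphase]
    omega
  · obtain ⟨S', hflip, hC', hlt⟩ := exists_flip_crossed h.generalPosition h.subset
      (fun p hp => h.notMem_convexHull hp) hS.2
      (fun s hs hc => by by_contra hn; exact hphase ⟨s, hs, hc, hn⟩) hcr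
    refine ⟨S', hflip, ?_⟩
    -- The new multiset is in the second phase as well, so both potentials count crossed segments.
    rw [potential, potential, if_neg hphase, if_neg]
    · exact hlt
    · rintro ⟨s, hs, hc, hn⟩
      exact hn (hC' s hs hc)

lemma Separated.exists_strategy {P C T₁ T₂ : Finset Plane} (h : Separated P C T₁ T₂) (n : ℕ) :
    ∃ RI : Digraph (Config P n), IsRIStrategy (flipGraph P n) RI ∧
      ∀ S : Config P n,
        (∃ σ : FlipSequence RI, σ.head = S ∧ IsUntangle (flipGraph P n) σ) ∧
        ∀ σ : FlipSequence RI, σ.head = S →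
          σ.length ≤ 3 * (n + degreeSum S.1 T₁ T₂ * P.card) ∧
          σ.length ≤ 3 * (max 1 (degreeSum S.1 T₁ T₂) * n) := by
  obtain ⟨R, hR, hex, hlen⟩ := exists_strategy_of_potential (flipGraph P n)
    (fun S => potential C n S.1) (by
      intro S hS
      simp only [IsSink, not_forall, not_not] at hS
      obtain ⟨S₁, a, b, c, d, U, hU, hcr, -⟩ := hS
      obtain ⟨S', hflip, hlt⟩ := h.exists_flip_potential S.2
        ⟨s(a, b), by rw [hU]; simp, s(c, d), by rw [hU]; simp, hcr⟩
      exact ⟨⟨S', hflip.isConfig S.2⟩, hflip, hlt⟩)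
  refine ⟨R, hR, fun S => ⟨hex S, ?_⟩⟩
  rintro σ rfl
  set S := σ.head
  have h1 : σ.length ≤ potential C n S.1 := hlen σ
  have h2 : potential C n S.1 ≤ _ := potential_le S.2.1
  have h3 := sum_stretch_le h (fun s hs => (S.2.2 s hs).2) (active S.1)
  have h4 : (active S.1).card ≤ P.card := by
    refine Finset.card_le_card fun p hp => ?_
    obtain ⟨s, hs, hps⟩ := mem_active.1 hp
    exact (S.2.2 s hs).2 p hps
  have h5 := card_active_le S.1
  rw [S.2.1] at h5
  have h6 := Nat.mul_le_mul_left (degreeSum S.1 T₁ T₂) h4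
  have h7 := Nat.mul_le_mul_left (degreeSum S.1 T₁ T₂) h5
  have h8 := Nat.mul_le_mul_right n (le_max_left 1 (degreeSum S.1 T₁ T₂))
  have h9 := Nat.mul_le_mul_right n (le_max_right 1 (degreeSum S.1 T₁ T₂))
  have h10 : degreeSum S.1 T₁ T₂ * (2 * n) = 2 * (degreeSum S.1 T₁ T₂ * n) := by ring
  -- The length is at most `n + t * |P|` and at most `n + 2 * t * n`; the constant 3 covers the
  -- latter, as `n` and `t * n` are both at most `max 1 t * n`.
  constructor <;> omega

end Untangle

open Untangle
theorem mainTheorem9 :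
    ∃ K : ℕ,
      (∀ (P C T₁ T₂ : Finset Plane), Separated P C T₁ T₂ → ∀ n : ℕ,
        ∃ RI : Digraph (Config P n), IsRIStrategy (flipGraph P n) RI ∧
          ∀ S : Config P n,
            (∃ σ : FlipSequence RI, σ.head = S ∧ IsUntangle (flipGraph P n) σ) ∧
            ∀ σ : FlipSequence RI, σ.head = S →
              σ.length ≤ K * (n + degreeSum S.1 T₁ T₂ * P.card) ∧
              σ.length ≤ K * (max 1 (degreeSum S.1 T₁ T₂) * n)) ∧
      ∀ n t : ℕ, dRI n t ≤ ((K * (max 1 t * n) : ℕ) : ℕ∞) := by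
  refine ⟨3, fun P C T₁ T₂ h n => h.exists_strategy n, fun n t => ?_⟩
  refine iSup_le fun P => iSup_le fun C => iSup_le fun T₁ => iSup_le fun T₂ => iSup_le fun h => ?_
  obtain ⟨R, hR, hlen⟩ := h.exists_strategy n
  refine iInf₂_le_of_le R hR (iSup₂_le fun σ hσ => ?_)
  have := ((hlen σ.head).2 σ rfl).2
  rw [hσ] at this
  exact_mod_cast this
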